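/- **Setting.** Let $\mathcal I,\mathcal J,\mathcal K,\mathcal Z$ be finite sets (battery chemistries, recycling processes, materials, zones) and let $\mathcal K^{CP}\subseteq\mathcal K$ (cathode powders); write $\mathcal K'=\mathcal K\setminus\mathcal K^{CP}$. Periods are $t\in\mathcal T=\{1,\dots,T\}$, planning periods are $l\in\mathcal L=\{1,\dots,L\}$, and $l_t\in\mathcal L$ is the planning period of $t$. Each $t\in\{0,\dots,T\}$ has a stage $\sigma_t\in\{1,\dots,S\}$, nondecreasing in $t$. The scenario tree has a finite node set $\Omega_\sigma$ at each stage $\sigma$, node probabilities $p_\omega$ with $\sum_{\omega\in\Omega_\sigma}p_\omega=1$ for every $\sigma$, and $a_\omega(t)\in\Omega_{\sigma_t}$ is the ancestor of $\omega$ at stage $\sigma_t$ (with $a_\omega(t)=\omega$ if $\omega\in\Omega_{\sigma_t}$). In planning period $l$ there are at most $N^{R}_l\ge 1$ recycling facilities in each zone and at most $N^{C}_{l,k}\ge 1$ cathode production lines for each $k\in\mathcal K^{CP}$ in each zone. The parameters $p,d,s,c,v,\Delta$ are nonnegative reals, $\rho\ge 0$, $0\le\eta\le 1$, $u^R,u^C>0$,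 $\gamma\in[0,1)$, and the cost functions $f^R_{z,j},f^C_{z,k}:[0,\infty)\to\mathbb R$ are concave, monotone increasing, and vanish at $0$. **Operational constraints** in the variables $x\ge 0$. For all $t\in\mathcal T$, $\omega\in\Omega_{\sigma_t}$, $z\in\mathcal Z$: - $\sum_i\Delta^{NB}_{i,k}d_{\omega,z,t,i}=x^{NM,NB}_{\omega,z,t,k}+x^{INV,NB}_{\omega,z,t,k}$ for $k\in\mathcal K^{CP}$, and $\sum_i\Delta^{NB}_{i,k}d_{\omega,z,t,i}=x^{NM,NB}_{\omega,z,t,k}$ for $k\in\mathcal K'$; - $\sum_{k'\in\mathcal K^{CP}}\Delta^{CP}_{k',k}x^{CP,INV}_{\omega,z,t,k'}=x^{NM,CP}_{\omega,z,t,k}+x^{MC,CP}_{\omega,z,t,k}$ and $\sum_{k'\in\mathcal K'}\Delta^{MC}_{k',k}x^{MC,CP}_{\omega,z,t,k'}=x^{INV,MC}_{\omega,z,t,k}$ for $k\in\mathcal K'$; - $x^{RM,INV}_{\omega,z,t,k}+x^{RM,S}_{\omega,z,t,k}=\sum_{i,j}\Delta^{REC}_{k,i,j}x^{RB,RM}_{\omega,z,t,i,j}$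 for $k\in\mathcal K$; - with $\omega'=a_\omega(t-1)$, $x^{RB}_{\omega,z,t,i}=x^{RB}_{\omega',z,t-1,i}+\sum_{z'\ne z}(x^{TR,RB}_{\omega,z',z,t,i}-x^{TR,RB}_{\omega,z,z',t,i})+s_{\omega,z,t,i}-\sum_j x^{RB,RM}_{\omega,z,t,i,j}$ for $i\in\mathcal I$; - with $\omega'=a_\omega(t-1)$, $x^{INV}_{\omega,z,t,k}=x^{INV}_{\omega',z,t-1,k}+\sum_{z'\ne z}(x^{TR,RM}_{\omega,z',z,t,k}-x^{TR,RM}_{\omega,z,z',t,k})+x^{RM,INV}_{\omega,z,t,k}+e_{\omega,z,t,k}$, where $e_{\omega,z,t,k}=-x^{INV,MC}_{\omega,z,t,k}$ for $k\in\mathcal K'$ and $e_{\omega,z,t,k}=x^{CP,INV}_{\omega,z,t,k}-x^{INV,NB}_{\omega,z,t,k}$ for $k\in\mathcal K^{CP}$; - initially, $x^{RB}_{\omega,z,0,i}=0$ and $x^{INV}_{\omega,z,0,k}=0$ for all $\omega\in\Omega_{\sigma_0}$. The operational cost is $$\begin{aligned}C^{OP}_{\omega,t}(x)=\sum_z\Big(&\sum_{k\in\mathcal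 K}c^{NB,NM}_{\omega,t,k}x^{NM,NB}_{\omega,z,t,k}+\sum_{k\in\mathcal K'}\big(c^{CP,NM}_{\omega,t,k}x^{NM,CP}_{\omega,z,t,k}+c^{MC}_{\omega,z,t,k}x^{MC,CP}_{\omega,z,t,k}\big)+\sum_{k\in\mathcal K}v_{\omega,t,k}\big(\rho x^{INV}_{\omega,z,t,k}-\eta x^{RM,S}_{\omega,z,t,k}\big)\\&+\sum_{k\in\mathcal K^{CP}}c^{CP}_{\omega,z,t,k}x^{CP,INV}_{\omega,z,t,k}+\sum_{i,j}c^{REC}_{\omega,z,t,i,j}x^{RB,RM}_{\omega,z,t,i,j}+\sum_{z'\neq z}\Big(\sum_{k\in\mathcal K}c^{TR,RM}_{z,z'}x^{TR,RM}_{\omega,z,z',t,k}+\sum_i c^{TR,RB}_{z,z'}x^{TR,RB}_{\omega,z,z',t,i}\Big)\Big).\end{aligned}$$ **Model (P)** has, besides $x$, capacity variables $0\le y^R_{z,l,j,n}\le u^R$ ($n=1,\dots,N^R_l$) and $0\le y^C_{z,l,k,n}\le u^C$ ($n=1,\dots,N^C_{l,k}$). Put $Y^R_{z,l,j}=\sum_n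 y^R_{z,l,j,n}$ and $Y^C_{z,l,k}=\sum_n y^C_{z,l,k,n}$. The capacity constraints, for all $z\in\mathcal Z$, $j\in\mathcal J$, $k\in\mathcal K^{CP}$, are $$\sum_i x^{RB,RM}_{\omega,z,t,i,j}\le Y^R_{z,l_t,j},\quad x^{CP,INV}_{\omega,z,t,k}\le Y^C_{z,l_t,k}\quad(t\in\mathcal T,\ \omega\in\Omega_{\sigma_t}),\qquad Y^R_{z,l-1,j}\le Y^R_{z,l,j},\quad Y^C_{z,l-1,k}\le Y^C_{z,l,k}\quad(2\le l\le L).$$ The planning cost is $C^{PL}_t(y)=\sum_z\big(\sum_j\sum_n f^R_{z,j}(y^R_{z,l_t,j,n})+\sum_{k\in\mathcal K^{CP}}\sum_n f^C_{z,k}(y^C_{z,l_t,k,n})\big)$. Model (P) minimizes $$\sum_{t\in\mathcal T}(1-\gamma)^{t-1}\Big(C^{PL}_t(y)+\sum_{\omega\in\Omega_{\sigma_t}}p_\omega C^{OP}_{\omega,t}(x)\Big).$$ **Model (PMI)** has the same $x$, operational constraints and operational cost, but its capacity variables are the integers $y^R_{z,l,j}\in\{0,\dots,N^R_l-1\}$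 and $y^C_{z,l,k}\in\{0,\dots,N^C_{l,k}-1\}$ (numbers of facilities and lines at full capacity) and the reals $0\le y^R_{z,l,j,+}\le u^R$ and $0\le y^C_{z,l,k,+}\le u^C$. Its capacity constraints are those of (P) with $Y^R_{z,l,j}=u^Ry^R_{z,l,j}+y^R_{z,l,j,+}$ and $Y^C_{z,l,k}=u^Cy^C_{z,l,k}+y^C_{z,l,k,+}$, and its objective is that of (P) with $C^{PL}_t$ replaced by $$\overline C^{PL}_t(y)=\sum_z\Big(\sum_j\big(f^R_{z,j}(y^R_{z,l_t,j,+})+y^R_{z,l_t,j}f^R_{z,j}(u^R)\big)+\sum_{k\in\mathcal K^{CP}}\big(f^C_{z,k}(y^C_{z,l_t,k,+})+y^C_{z,l_t,k}f^C_{z,k}(u^C)\big)\Big).$$ **Theorem.** The models (P) and (PMI) have the same optimal objective value: both minima are attained, and they are equal. -/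

import Mathlib

open scoped BigOperators

universe u

namespace BatteryModel

/-- Index sets of the supply chain model: `I` are the battery chemistries, `J` the recycling
processes, `K` the materials and `Z` the zones.

Periods are numbered `0, 1, …, T`, where `0` is the initial period. An element `t : Fin T` stands
for the period `t + 1`, i.e. for `t.succ : Fin (T + 1)`; the preceding period is
`t.castSucc : Fin (T + 1)`. -/
structure Setting (K : Type u) where
  /-- number of time periods -/
  T : ℕ
  /-- number of planning periods -/
  L : ℕ
  /-- number of stages -/
  S : ℕ
  /-- planning period of a time period -/
  plan : Fin T → Fin L
  /-- stage of a time period, the initial period included -/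
  stage : Fin (T + 1) → Fin S
  /-- stages are passed through in chronological order -/
  stage_mono : Monotone stage
  /-- scenario tree nodes at each stage -/
  node : Fin S → Type u
  /-- each stage has finitely many nodes -/
  nodeFintype : ∀ s, Fintype (node s)
  /-- the ancestor, at an earlier or equal stage, of a node of the scenario tree -/
  anc : ∀ {s s' : Fin S}, s ≤ s' → node s' → node s
  /-- a node is its own ancestor at its own stage -/
  anc_self : ∀ (s : Fin S) (w : node s), anc (le_refl s) w = w
  /-- ancestors of ancestors are ancestors -/
  anc_anc : ∀ {s s' s'' : Fin S} (h : s ≤ s') (h' : s' ≤ s'') (w : node s''),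
    anc h (anc h' w) = anc (h.trans h') w
  /-- the cathode powders among the materials -/
  cathodes : Finset K
  /-- number of recycling facilities in each planning period -/
  nREC : Fin L → ℕ
  /-- number of cathode production lines in each planning period, for each cathode powder -/
  nCP : Fin L → {k : K // k ∈ cathodes} → ℕ

attribute [instance] Setting.nodeFintype

namespace Setting

variable {K : Type u}

/-- The cathode powders. -/
abbrev Cath (M : Setting K) : Type u := {k : K // k ∈ M.cathodes}

/-- The materials that are not cathode powders. -/
abbrev NonCath (M : Setting K) : Type u := {k : K // k ∉ M.cathodes}

/-- The scenario tree nodes at the stage of a period in `0, …, T`. -/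
abbrev NodeAt (M : Setting K) (t : Fin (M.T + 1)) : Type u := M.node (M.stage t)

/-- The scenario tree nodes at the stage of a period in `1, …, T`. -/
abbrev Node (M : Setting K) (t : Fin M.T) : Type u := M.NodeAt t.succ

/-- The ancestor of a node at the preceding period. -/
def prev (M : Setting K) (t : Fin M.T) (w : M.Node t) : M.NodeAt t.castSucc :=
  M.anc (M.stage_mono (Fin.castSucc_le_succ t)) w

end Setting

/-- The numerical data of the model. -/
structure Params (I J : Type u) {K : Type u} (Z : Type u) (M : Setting K) where
  /-- node probabilities -/
  p : ∀ s : Fin M.S, M.node s → ℝ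
  /-- new battery demand -/
  d : ∀ t : Fin M.T, M.Node t → Z → I → ℝ
  /-- retired battery supply -/
  s : ∀ t : Fin M.T, M.Node t → Z → I → ℝ
  /-- material needed for batteries -/
  ΔNB : I → K → ℝ
  /-- `ΔCP k' k`: material `k` needed for cathode powder `k'` -/
  ΔCP : M.Cath → M.NonCath → ℝ
  /-- `ΔMC k' k`: material `k` needed for material `k'` in material conversion -/
  ΔMC : M.NonCath → M.NonCath → ℝ
  /-- material recovered by recycling -/
  ΔREC : K → I → J → ℝ
  /-- purchase cost of new material for batteries -/
  cNBNM : ∀ t : Fin M.T, M.Node t → K → ℝ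
  /-- purchase cost of new material for cathode production -/
  cCPNM : ∀ t : Fin M.T, M.Node t → M.NonCath → ℝ
  /-- material conversion cost -/
  cMC : ∀ t : Fin M.T, M.Node t → Z → M.NonCath → ℝ
  /-- cathode production cost -/
  cCP : ∀ t : Fin M.T, M.Node t → Z → M.Cath → ℝ
  /-- recycling cost -/
  cREC : ∀ t : Fin M.T, M.Node t → Z → I → J → ℝ
  /-- transport cost of materials from a zone to another zone -/
  cTRRM : ∀ z : Z, {z' : Z // z' ≠ z} → ℝ
  /-- transport cost of batteries from a zone to another zone -/
  cTRRB : ∀ z : Z, {z' : Z // z' ≠ z} → ℝ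
  /-- material value -/
  v : ∀ t : Fin M.T, M.Node t → K → ℝ
  /-- inventory cost as a proportion of material value -/
  ρ : ℝ
  /-- sales revenue as a proportion of material value -/
  η : ℝ
  /-- discount factor -/
  γ : ℝ
  /-- maximum capacity of a recycling facility, for each process -/
  uREC : ℝ
  /-- maximum capacity of a cathode production line -/
  uCP : ℝ
  /-- capacity cost of a recycling facility; only its values on `[0, ∞)` matter -/
  fREC : Z → J → ℝ → ℝ
  /-- capacity cost of a cathode production line; only its values on `[0, ∞)` matter -/
  fCP : Z → M.Cath → ℝ → ℝ

/-- A capacity cost function: concave and increasing on `[0, ∞)`, with value `0` at `0`. -/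
structure IsCapacityCost (f : ℝ → ℝ) : Prop where
  concave : ConcaveOn ℝ (Set.Ici 0) f
  mono : MonotoneOn f (Set.Ici 0)
  zero : f 0 = 0

/-- The standing assumptions on the data. -/
structure Params.Standing {I J K Z : Type u} {M : Setting K} (D : Params I J Z M) : Prop where
  nREC_pos : ∀ l, 0 < M.nREC l
  nCP_pos : ∀ l k, 0 < M.nCP l k
  p_nonneg : ∀ s w, 0 ≤ D.p s w
  p_sum : ∀ s, ∑ w, D.p s w = 1
  d_nonneg : ∀ t w z i, 0 ≤ D.d t w z i
  s_nonneg : ∀ t w z i, 0 ≤ D.s t w z i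
  ΔNB_nonneg : ∀ i k, 0 ≤ D.ΔNB i k
  ΔCP_nonneg : ∀ k' k, 0 ≤ D.ΔCP k' k
  ΔMC_nonneg : ∀ k' k, 0 ≤ D.ΔMC k' k
  ΔREC_nonneg : ∀ k i j, 0 ≤ D.ΔREC k i j
  cNBNM_nonneg : ∀ t w k, 0 ≤ D.cNBNM t w k
  cCPNM_nonneg : ∀ t w k, 0 ≤ D.cCPNM t w k
  cMC_nonneg : ∀ t w z k, 0 ≤ D.cMC t w z k
  cCP_nonneg : ∀ t w z k, 0 ≤ D.cCP t w z k
  cREC_nonneg : ∀ t w z i j, 0 ≤ D.cREC t w z i j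
  cTRRM_nonneg : ∀ z z', 0 ≤ D.cTRRM z z'
  cTRRB_nonneg : ∀ z z', 0 ≤ D.cTRRB z z'
  v_nonneg : ∀ t w k, 0 ≤ D.v t w k
  ρ_nonneg : 0 ≤ D.ρ
  η_nonneg : 0 ≤ D.η
  η_le_one : D.η ≤ 1
  γ_nonneg : 0 ≤ D.γ
  γ_lt_one : D.γ < 1
  uREC_pos : 0 < D.uREC
  uCP_pos : 0 < D.uCP
  fREC_cost : ∀ z j, IsCapacityCost (D.fREC z j)
  fCP_cost : ∀ z k, IsCapacityCost (D.fCP z k)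

/-- The operational decisions `x`. -/
structure OpVars (I J : Type u) {K : Type u} (Z : Type u) (M : Setting K) where
  /-- new material used in batteries -/
  NMNB : ∀ t : Fin M.T, M.Node t → Z → K → ℝ
  /-- recycled material used in batteries -/
  INVNB : ∀ t : Fin M.T, M.Node t → Z → M.Cath → ℝ
  /-- new material used in cathode production -/
  NMCP : ∀ t : Fin M.T, M.Node t → Z → M.NonCath → ℝ
  /-- output of material conversion, used in cathode production -/
  MCCP : ∀ t : Fin M.T, M.Node t → Z → M.NonCath → ℝ
  /-- output of cathode production -/
  CPINV : ∀ t : Fin M.T, M.Node t → Z → M.Cath → ℝ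
  /-- input of material conversion -/
  INVMC : ∀ t : Fin M.T, M.Node t → Z → M.NonCath → ℝ
  /-- recycled material put in inventory -/
  RMINV : ∀ t : Fin M.T, M.Node t → Z → K → ℝ
  /-- recycled material sold -/
  RMS : ∀ t : Fin M.T, M.Node t → Z → K → ℝ
  /-- batteries recycled -/
  RBRM : ∀ t : Fin M.T, M.Node t → Z → I → J → ℝ
  /-- retired batteries in inventory -/
  RB : ∀ t : Fin (M.T + 1), M.NodeAt t → Z → I → ℝ
  /-- material in inventory -/
  INV : ∀ t : Fin (M.T + 1), M.NodeAt t → Z → K → ℝ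
  /-- batteries transported from a zone to another zone -/
  TRRB : ∀ t : Fin M.T, M.Node t → ∀ z : Z, {z' : Z // z' ≠ z} → I → ℝ
  /-- material transported from a zone to another zone -/
  TRRM : ∀ t : Fin M.T, M.Node t → ∀ z : Z, {z' : Z // z' ≠ z} → K → ℝ

/-- The capacity decisions `y` of the original model, one for each facility and line. -/
structure CapVars (J : Type u) {K : Type u} (Z : Type u) (M : Setting K) where
  /-- capacity of each recycling facility -/
  REC : Z → ∀ l : Fin M.L, J → Fin (M.nREC l) → ℝ
  /-- capacity of each cathode production line -/
  CP : Z → ∀ (l : Fin M.L) (k : M.Cath), Fin (M.nCP l k) → ℝ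

/-- The capacity decisions `y` of the reformulated model. -/
structure CapVarsMI (J : Type u) {K : Type u} (Z : Type u) (M : Setting K) where
  /-- number of recycling facilities at full capacity -/
  REC : Z → Fin M.L → J → ℕ
  /-- capacity of the recycling facility at partial capacity -/
  RECplus : Z → Fin M.L → J → ℝ
  /-- number of cathode production lines at full capacity -/
  CP : Z → Fin M.L → M.Cath → ℕ
  /-- capacity of the cathode production line at partial capacity -/
  CPplus : Z → Fin M.L → M.Cath → ℝ

section Model

variable {I J K Z : Type u} [Fintype I] [Fintype J] [Fintype K] [DecidableEq K]
  [Fintype Z] [DecidableEq Z] {M : Setting K}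

/-- Nonnegativity of the operational decisions. -/
structure OpVars.Nonneg (x : OpVars I J Z M) : Prop where
  NMNB : ∀ t w z k, 0 ≤ x.NMNB t w z k
  INVNB : ∀ t w z k, 0 ≤ x.INVNB t w z k
  NMCP : ∀ t w z k, 0 ≤ x.NMCP t w z k
  MCCP : ∀ t w z k, 0 ≤ x.MCCP t w z k
  CPINV : ∀ t w z k, 0 ≤ x.CPINV t w z k
  INVMC : ∀ t w z k, 0 ≤ x.INVMC t w z k
  RMINV : ∀ t w z k, 0 ≤ x.RMINV t w z k
  RMS : ∀ t w z k, 0 ≤ x.RMS t w z k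
  RBRM : ∀ t w z i j, 0 ≤ x.RBRM t w z i j
  RB : ∀ t w z i, 0 ≤ x.RB t w z i
  INV : ∀ t w z k, 0 ≤ x.INV t w z k
  TRRB : ∀ t w z z' i, 0 ≤ x.TRRB t w z z' i
  TRRM : ∀ t w z z' k, 0 ≤ x.TRRM t w z z' k

/-- The production constraints. -/
structure Production (D : Params I J Z M) (x : OpVars I J Z M) : Prop where
  /-- battery manufacturing, cathode powders -/
  nbCath : ∀ t w z (k : M.Cath),
    ∑ i, D.ΔNB i k * D.d t w z i = x.NMNB t w z k + x.INVNB t w z k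
  /-- battery manufacturing, other materials -/
  nbNonCath : ∀ t w z (k : M.NonCath),
    ∑ i, D.ΔNB i k * D.d t w z i = x.NMNB t w z k
  /-- cathode production -/
  cp : ∀ t w z (k : M.NonCath),
    ∑ k' : M.Cath, D.ΔCP k' k * x.CPINV t w z k' = x.NMCP t w z k + x.MCCP t w z k
  /-- material conversion -/
  mc : ∀ t w z (k : M.NonCath),
    ∑ k' : M.NonCath, D.ΔMC k' k * x.MCCP t w z k' = x.INVMC t w z k
  /-- recycling -/
  recy : ∀ t w z k,
    x.RMINV t w z k + x.RMS t w z k = ∑ i, ∑ j, D.ΔREC k i j * x.RBRM t w z i j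

/-- Net transport of batteries of chemistry `i` into the zone `z`. -/
def OpVars.netRB (x : OpVars I J Z M) (t : Fin M.T) (w : M.Node t) (z : Z) (i : I) : ℝ :=
  ∑ z' : {z' : Z // z' ≠ z}, (x.TRRB t w z' ⟨z, z'.2.symm⟩ i - x.TRRB t w z z' i)

/-- Net transport of material `k` into the zone `z`. -/
def OpVars.netRM (x : OpVars I J Z M) (t : Fin M.T) (w : M.Node t) (z : Z) (k : K) : ℝ :=
  ∑ z' : {z' : Z // z' ≠ z}, (x.TRRM t w z' ⟨z, z'.2.symm⟩ k - x.TRRM t w z z' k)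

/-- The inventory balance constraints. -/
structure Inventory (D : Params I J Z M) (x : OpVars I J Z M) : Prop where
  /-- no initial inventory of batteries -/
  initRB : ∀ w z i, x.RB 0 w z i = 0
  /-- no initial inventory of materials -/
  initINV : ∀ w z k, x.INV 0 w z k = 0
  /-- retired batteries -/
  rb : ∀ t (w : M.Node t) z i,
    x.RB t.succ w z i = x.RB t.castSucc (M.prev t w) z i + x.netRB t w z i
      + D.s t w z i - ∑ j, x.RBRM t w z i j
  /-- materials other than cathode powders -/
  invNonCath : ∀ t (w : M.Node t) z (k : M.NonCath),
    x.INV t.succ w z k = x.INV t.castSucc (M.prev t w) z k + x.netRM t w z k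
      + x.RMINV t w z k - x.INVMC t w z k
  /-- cathode powders -/
  invCath : ∀ t (w : M.Node t) z (k : M.Cath),
    x.INV t.succ w z k = x.INV t.castSucc (M.prev t w) z k + x.netRM t w z k
      + x.RMINV t w z k + x.CPINV t w z k - x.INVNB t w z k

/-- The capacity constraints of the original model, and `y ≥ 0`. -/
structure Capacity (D : Params I J Z M) (x : OpVars I J Z M) (y : CapVars J Z M) : Prop where
  recCap : ∀ j t z w, ∑ i, x.RBRM t w z i j ≤ ∑ n, y.REC z (M.plan t) j n
  cpCap : ∀ (k : M.Cath) t z w, x.CPINV t w z k ≤ ∑ n, y.CP z (M.plan t) k n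
  recMono : ∀ j (l' l : Fin M.L) z, (l' : ℕ) + 1 = l → ∑ n, y.REC z l' j n ≤ ∑ n, y.REC z l j n
  cpMono : ∀ (k : M.Cath) (l' l : Fin M.L) z, (l' : ℕ) + 1 = l →
    ∑ n, y.CP z l' k n ≤ ∑ n, y.CP z l k n
  recUB : ∀ j l z n, y.REC z l j n ≤ D.uREC
  cpUB : ∀ (k : M.Cath) l z n, y.CP z l k n ≤ D.uCP
  recNonneg : ∀ j l z n, 0 ≤ y.REC z l j n
  cpNonneg : ∀ (k : M.Cath) l z n, 0 ≤ y.CP z l k n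

/-- The capacity constraints of the reformulated model, and `y ≥ 0`. -/
structure CapacityMI (D : Params I J Z M) (x : OpVars I J Z M) (y : CapVarsMI J Z M) :
    Prop where
  recCap : ∀ j t z w, ∑ i, x.RBRM t w z i j ≤
    D.uREC * y.REC z (M.plan t) j + y.RECplus z (M.plan t) j
  cpCap : ∀ (k : M.Cath) t z w, x.CPINV t w z k ≤
    D.uCP * y.CP z (M.plan t) k + y.CPplus z (M.plan t) k
  recMono : ∀ j (l' l : Fin M.L) z, (l' : ℕ) + 1 = l →
    D.uREC * y.REC z l' j + y.RECplus z l' j ≤ D.uREC * y.REC z l j + y.RECplus z l j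
  cpMono : ∀ (k : M.Cath) (l' l : Fin M.L) z, (l' : ℕ) + 1 = l →
    D.uCP * y.CP z l' k + y.CPplus z l' k ≤ D.uCP * y.CP z l k + y.CPplus z l k
  /-- the number of full facilities is one of `0, …, nREC l - 1` -/
  recInt : ∀ j l z, y.REC z l j < M.nREC l
  /-- the number of full lines is one of `0, …, nCP l k - 1` -/
  cpInt : ∀ (k : M.Cath) l z, y.CP z l k < M.nCP l k
  recUB : ∀ j l z, y.RECplus z l j ≤ D.uREC
  cpUB : ∀ (k : M.Cath) l z, y.CPplus z l k ≤ D.uCP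
  recNonneg : ∀ j l z, 0 ≤ y.RECplus z l j
  cpNonneg : ∀ (k : M.Cath) l z, 0 ≤ y.CPplus z l k

/-- Operational cost of a period at a node. -/
noncomputable def costOP (D : Params I J Z M) (x : OpVars I J Z M) (t : Fin M.T)
    (w : M.Node t) : ℝ :=
  ∑ z, ((∑ k, D.cNBNM t w k * x.NMNB t w z k)
    + (∑ k : M.NonCath, (D.cCPNM t w k * x.NMCP t w z k + D.cMC t w z k * x.MCCP t w z k))
    + (∑ k, D.v t w k * (D.ρ * x.INV t.succ w z k - D.η * x.RMS t w z k))
    + (∑ k : M.Cath, D.cCP t w z k * x.CPINV t w z k)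
    + (∑ i, ∑ j, D.cREC t w z i j * x.RBRM t w z i j)
    + ∑ z' : {z' : Z // z' ≠ z}, ((∑ k, D.cTRRM z z' * x.TRRM t w z z' k)
        + ∑ i, D.cTRRB z z' * x.TRRB t w z z' i))

/-- Planning cost of a period in the original model. -/
noncomputable def costPL (D : Params I J Z M) (y : CapVars J Z M) (t : Fin M.T) : ℝ :=
  ∑ z, ((∑ j, ∑ n, D.fREC z j (y.REC z (M.plan t) j n))
    + ∑ k : M.Cath, ∑ n, D.fCP z k (y.CP z (M.plan t) k n))

/-- Planning cost of a period in the reformulated model. -/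
noncomputable def costPLMI (D : Params I J Z M) (y : CapVarsMI J Z M) (t : Fin M.T) : ℝ :=
  ∑ z, ((∑ j, (D.fREC z j (y.RECplus z (M.plan t) j)
        + y.REC z (M.plan t) j * D.fREC z j D.uREC))
    + ∑ k : M.Cath, (D.fCP z k (y.CPplus z (M.plan t) k)
        + y.CP z (M.plan t) k * D.fCP z k D.uCP))

/-- Total discounted expected cost, for given planning costs. The element `t : Fin T` is the
period `t + 1`, so that its discount exponent is `t`. -/
noncomputable def totalCost (D : Params I J Z M) (planning : Fin M.T → ℝ)
    (x : OpVars I J Z M) : ℝ :=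
  ∑ t : Fin M.T, (1 - D.γ) ^ (t : ℕ) *
    (planning t + ∑ w : M.Node t, D.p (M.stage t.succ) w * costOP D x t w)

/-- Feasible region of the original model (P). -/
def feasibleP (D : Params I J Z M) : Set (OpVars I J Z M × CapVars J Z M) :=
  {q | q.1.Nonneg ∧ Production D q.1 ∧ Inventory D q.1 ∧ Capacity D q.1 q.2}

/-- Objective function of the original model (P). -/
noncomputable def objectiveP (D : Params I J Z M) (q : OpVars I J Z M × CapVars J Z M) : ℝ :=
  totalCost D (costPL D q.2) q.1

/-- Feasible region of the reformulated model (PMI). -/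
def feasiblePMI (D : Params I J Z M) : Set (OpVars I J Z M × CapVarsMI J Z M) :=
  {q | q.1.Nonneg ∧ Production D q.1 ∧ Inventory D q.1 ∧ CapacityMI D q.1 q.2}

/-- Objective function of the reformulated model (PMI). -/
noncomputable def objectivePMI (D : Params I J Z M)
    (q : OpVars I J Z M × CapVarsMI J Z M) : ℝ :=
  totalCost D (costPLMI D q.2) q.1

end Model

/-- `v` is the optimal value of the problem of minimizing `obj` over `feas`: the smallest value
that `obj` takes at a feasible point. -/
def IsOptimalValue {X : Type u} (feas : Set X) (obj : X → ℝ) (v : ℝ) : Prop :=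
  IsLeast (obj '' feas) v

end BatteryModel

/-! The operational constraints see the capacities only through their totals, so comparing the
models amounts to splitting a total among identical facilities. Under a concave cost, shifting
capacity between two facilities until one is empty or the other full does not raise the sum of their
costs (`add_le_add_of_mem_Icc`). Iterating leaves full facilities, one partial one, and empty ones
that cost nothing (`exists_full_add_partial`). Conversely, `spread` lays out a solution of (PMI) as
such a configuration at equal cost. Hence attainment has to be proved for (P) only.

Attainment in (P) is not plain compactness: goods may circulate between zones in unbounded amounts,
possibly for free, and the capacity costs may jump at `0`. However, capacities bound recycling and
cathode production, hence also sales revenue and every linear form that the constraints prescribe. A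
nonnegative vector of minimal support in a fibre of a linear map is bounded in terms of its image
(`LinearMap.exists_nonneg_norm_le`). Applied to the forms together with the cost, this replaces a
feasible point of controlled cost by a bounded one of the same cost, and lower semicontinuity on a
compact set concludes (`exists_isMinOn_linear_add`). -/

/-! ### Attainment of minima with an unbounded nonnegative variable -/

/-- A nonnegative vector can be replaced by one with the same image under a linear map and with
norm controlled by that image. -/
theorem LinearMap.exists_nonneg_norm_le {ι F : Type*} [Fintype ι] [NormedAddCommGroup F]
    [NormedSpace ℝ F] (A : (ι → ℝ) →ₗ[ℝ] F) :
    ∃ C : ℝ, 0 ≤ C ∧ ∀ x : ι → ℝ, 0 ≤ x → ∃ x' : ι → ℝ, 0 ≤ x' ∧ A x' = A x ∧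
      ‖x'‖ ≤ C * ‖A x‖ := by
  classical
  -- There are finitely many supports `s`, so one constant per support suffices; the constant `0` is
  -- a dummy when `A` is not injective on vectors supported in `s`.
  have hbound : ∀ s : Finset ι, ∃ C : ℝ, 0 ≤ C ∧
      ((∀ v : ι → ℝ, (∀ i ∉ s, v i = 0) → A v = 0 → v = 0) →
        ∀ v : ι → ℝ, (∀ i ∉ s, v i = 0) → ‖v‖ ≤ C * ‖A v‖) := by
    intro s
    by_cases hs : ∀ v : ι → ℝ, (∀ i ∉ s, v i = 0) → A v = 0 → v = 0
    · let V : Submodule ℝ (ι → ℝ) :=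
        { carrier := {v | ∀ i ∉ s, v i = 0}
          add_mem' := fun ha hb i hi => by simp [ha i hi, hb i hi]
          zero_mem' := fun i _ => rfl
          smul_mem' := fun c v hv i hi => by simp [hv i hi] }
      have hker : LinearMap.ker (A.comp V.subtype) = ⊥ := by
        rw [LinearMap.ker_eq_bot']
        intro v hv
        exact Subtype.ext (hs v v.2 hv)
      obtain ⟨K, -, hK⟩ := LinearMap.exists_antilipschitzWith _ hker
      refine ⟨K, K.2, fun _ v hv => ?_⟩
      have := hK.le_mul_dist ⟨v, hv⟩ 0
      simpa [dist_eq_norm] using this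
    · exact ⟨0, le_rfl, fun h => absurd h hs⟩
  choose C hC0 hC using hbound
  refine ⟨∑ s, C s, Finset.sum_nonneg fun s _ => hC0 s, fun x hx => ?_⟩
  -- A point of minimal support in the fibre plays the role of a basic solution in linear
  -- programming.
  let P : ℕ → Prop := fun n => ∃ v : ι → ℝ, 0 ≤ v ∧ A v = A x ∧
    (Finset.univ.filter fun i => v i ≠ 0).card = n
  have hP : ∃ n, P n := ⟨_, x, hx, rfl, rfl⟩
  obtain ⟨x', hx', hAx', hcard⟩ := Nat.find_spec hP
  refine ⟨x', hx', hAx', ?_⟩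
  set s := Finset.univ.filter fun i => x' i ≠ 0 with hs
  have key : ∀ v : ι → ℝ, (∀ i ∉ s, v i = 0) → A v = 0 → ∀ i, v i ≤ 0 := by
    intro v hv hAv
    by_contra! hpos
    obtain ⟨i₀, hi₀⟩ := hpos
    -- Ratio test: the smallest `x' i / v i` over `0 < v i` is the longest step along `-v` that
    -- keeps the vector nonnegative. It empties coordinate `i`, and the support gains nothing
    -- because `v` vanishes off `s`, contradicting minimality.
    obtain ⟨i, hi, hmin⟩ := (Finset.univ.filter fun i => 0 < v i).exists_min_image
      (fun i => x' i / v i) ⟨i₀, by simpa using hi₀⟩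
    have hvi : 0 < v i := by simpa using hi
    have his : i ∈ s := by
      by_contra h
      exact hvi.ne' (hv i h)
    have hθ : 0 ≤ x' i / v i := div_nonneg (hx' i) hvi.le
    refine Nat.find_min hP (m := (Finset.univ.filter fun j =>
      (x' - (x' i / v i) • v) j ≠ 0).card) ?_ ⟨x' - (x' i / v i) • v, ?_, ?_, rfl⟩
    · rw [← hcard]
      refine Finset.card_lt_card ((Finset.ssubset_iff_of_subset ?_).2 ⟨i, his, ?_⟩)
      · intro j hj
        by_contra hjs
        have h1 : x' j = 0 := by simpa [hs] using hjs
        simp [h1, hv j hjs] at hj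
      · simp [hvi.ne']
    · intro j
      simp only [Pi.zero_apply, Pi.sub_apply, Pi.smul_apply, smul_eq_mul, sub_nonneg]
      rcases lt_or_ge 0 (v j) with h | h
      · exact (le_div_iff₀ h).1 (hmin j (by simpa using h))
      · exact (mul_nonpos_of_nonneg_of_nonpos hθ h).trans (hx' j)
    · rw [map_sub, map_smul, hAv, smul_zero, sub_zero, hAx']
  have hinj : ∀ v : ι → ℝ, (∀ i ∉ s, v i = 0) → A v = 0 → v = 0 := by
    intro v hv hAv
    ext i
    refine le_antisymm (key v hv hAv i) ?_
    have := key (-v) (fun i hi => by simp [hv i hi]) (by simp [hAv]) i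
    simpa using this
  calc ‖x'‖ ≤ C s * ‖A x'‖ := hC s hinj x' fun i hi => by simpa [hs] using hi
    _ = C s * ‖A x‖ := by rw [hAx']
    _ ≤ (∑ s, C s) * ‖A x‖ := by
      gcongr
      exact Finset.single_le_sum (fun s _ => hC0 s) (Finset.mem_univ s)

/-- Attainment of the minimum of a linear cost plus a lower semicontinuous cost, where the
nonnegative first variable is possibly unbounded but constrained only through a linear map. -/
theorem exists_isMinOn_linear_add {ι F Y : Type*} [Fintype ι] [NormedAddCommGroup F]
    [NormedSpace ℝ F] [TopologicalSpace Y] (A : (ι → ℝ) →ₗ[ℝ] F) (c : (ι → ℝ) →ₗ[ℝ] ℝ)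
    {g : Y → ℝ} (hg : LowerSemicontinuous g) {S : Set ((ι → ℝ) × Y)} (hS : IsClosed S)
    (hne : S.Nonempty) {K : Set Y} (hK : IsCompact K) (hSK : ∀ q ∈ S, q.2 ∈ K)
    (hnonneg : ∀ q ∈ S, 0 ≤ q.1)
    (hcongr : ∀ q ∈ S, ∀ x, 0 ≤ x → A x = A q.1 → (x, q.2) ∈ S)
    {B : Set F} (hB : Bornology.IsBounded B) (hA : ∀ q ∈ S, A q.1 ∈ B)
    {m : ℝ} (hc : ∀ q ∈ S, m ≤ c q.1) :
    ∃ q ∈ S, IsMinOn (fun q => c q.1 + g q.2) S q := by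
  obtain ⟨q₀, hq₀⟩ := hne
  obtain ⟨y₁, -, hy₁⟩ := (hg.lowerSemicontinuousOn K).exists_isMinOn ⟨_, hSK _ hq₀⟩ hK
  obtain ⟨R, hR⟩ := hB.exists_norm_le
  -- The cost is adjoined to `A`, so that the bounded replacement keeps the cost as well as the
  -- constraints.
  obtain ⟨C, hC0, hC⟩ := (A.prod c).exists_nonneg_norm_le
  set V := c q₀.1 + g q₀.2
  -- Bound on the image of points no worse than `q₀`: `R` for the forms, and for the linear cost the
  -- interval from `m` to `V - g y₁`, where `g y₁` is the minimum of `g` on `K`.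
  set R' := max R (max |m| |V - g y₁|)
  have hred : ∀ q ∈ S, c q.1 + g q.2 ≤ V → ∃ x, ‖x‖ ≤ C * R' ∧ c x = c q.1 ∧ (x, q.2) ∈ S := by
    intro q hq hqV
    obtain ⟨x, hx, hAx, hxn⟩ := hC q.1 (hnonneg q hq)
    have h1 : A x = A q.1 := congrArg Prod.fst hAx
    have h2 : c x = c q.1 := congrArg Prod.snd hAx
    refine ⟨x, hxn.trans (mul_le_mul_of_nonneg_left ?_ hC0), h2, hcongr q hq x hx h1⟩
    refine max_le ((hR _ (hA q hq)).trans (le_max_left _ _)) (le_trans ?_ (le_max_right _ _))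
    have h3 : g y₁ ≤ g q.2 := hy₁ (hSK q hq)
    change |c q.1| ≤ _
    exact abs_le_max_abs_abs (hc q hq) (by linarith)
  set S' := S ∩ (Metric.closedBall (0 : ι → ℝ) (C * R') ×ˢ K)
  have hS' : IsCompact S' := ((isCompact_closedBall _ _).prod hK).inter_left hS
  have hlsc : LowerSemicontinuous fun q : (ι → ℝ) × Y => c q.1 + g q.2 := by
    refine LowerSemicontinuous.add ?_ ?_
    · exact ((LinearMap.continuous_of_finiteDimensional c).comp
        continuous_fst).lowerSemicontinuous
    · exact hg.comp continuous_snd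
  obtain ⟨x₀, hx₀, hcx₀, hx₀S⟩ := hred q₀ hq₀ le_rfl
  obtain ⟨q, hq, hmin⟩ := (hlsc.lowerSemicontinuousOn S').exists_isMinOn
    (⟨(x₀, q₀.2), ⟨hx₀S, by simpa using hx₀, hSK q₀ hq₀⟩⟩ : S'.Nonempty) hS'
  refine ⟨q, hq.1, fun r hr => ?_⟩
  rcases le_total (c r.1 + g r.2) V with h | h
  · obtain ⟨x, hx, hcx, hxS⟩ := hred r hr h
    have : c q.1 + g q.2 ≤ c x + g r.2 :=
      hmin (⟨hxS, by simpa using hx, hSK r hr⟩ : (x, r.2) ∈ S')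
    simpa [hcx] using this
  · have : c q.1 + g q.2 ≤ c x₀ + g q₀.2 :=
      hmin (⟨hx₀S, by simpa using hx₀, hSK q₀ hq₀⟩ : (x₀, q₀.2) ∈ S')
    rw [hcx₀] at this
    exact this.trans h

namespace BatteryModel

/-! ### Concave capacity costs and aggregation of facilities -/

namespace IsCapacityCost

variable {f : ℝ → ℝ}

theorem nonneg (hf : IsCapacityCost f) {x : ℝ} (hx : 0 ≤ x) : 0 ≤ f x := by
  simpa [hf.zero] using hf.mono (Set.mem_Ici.2 le_rfl) hx hx

/-- Concavity gives continuity on the open half-line only. At `0` the cost may jump upwards, as a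
fixed charge does, which lower semicontinuity tolerates since `f 0 = 0` is the least value. -/
theorem lowerSemicontinuous (hf : IsCapacityCost f) :
    LowerSemicontinuous fun x => f (max x 0) := by
  intro x
  rcases le_or_gt x 0 with hx | hx
  · intro y hy
    simp only [max_eq_right hx, hf.zero] at hy
    exact Filter.Eventually.of_forall fun z => hy.trans_le (hf.nonneg (le_max_right z 0))
  · have h1 : ContinuousAt f x := by
      have := hf.concave.continuousOn_interior
      rw [interior_Ici] at this
      exact this.continuousAt (Ioi_mem_nhds hx)
    refine ContinuousAt.lowerSemicontinuousAt (ContinuousAt.comp (g := f) ?_ (by fun_prop))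
    rwa [max_eq_left hx.le]

/-- Moving capacity from a facility to another one, up to emptying the first or filling the
second, does not increase the cost. -/
theorem add_le_add_of_mem_Icc (hf : IsCapacityCost f) {a b r s : ℝ} (hr : 0 ≤ r)
    (hra : r ≤ a) (hrb : r ≤ b) (h : r + s = a + b) : f r + f s ≤ f a + f b := by
  have has : a ≤ s := by linarith
  have hbs : b ≤ s := by linarith
  rcases (hra.trans has).eq_or_lt with hrs | hrs
  · have h1 : a = r := by linarith
    have h2 : b = s := by linarith
    rw [h1, h2]
  have hd : 0 < s - r := sub_pos.2 hrs
  have hs : 0 ≤ s := hr.trans hrs.le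
  -- Both `a` and `b` are convex combinations of `r` and `s`. Since `r + s = a + b`, their weights
  -- are swapped, and the two concavity inequalities add up to the claim.
  have h1 := hf.concave.2 (Set.mem_Ici.2 hr) (Set.mem_Ici.2 hs)
    (div_nonneg (sub_nonneg.2 has) hd.le) (div_nonneg (sub_nonneg.2 hra) hd.le)
    (by field_simp; ring)
  have h2 := hf.concave.2 (Set.mem_Ici.2 hr) (Set.mem_Ici.2 hs)
    (div_nonneg (sub_nonneg.2 hbs) hd.le) (div_nonneg (sub_nonneg.2 hrb) hd.le)
    (by field_simp; ring)
  have e1 : ((s - a) / (s - r)) • r + ((a - r) / (s - r)) • s = a := by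
    simp only [smul_eq_mul]; field_simp; ring
  have e2 : ((s - b) / (s - r)) • r + ((b - r) / (s - r)) • s = b := by
    simp only [smul_eq_mul]; field_simp; ring
  rw [e1] at h1
  rw [e2] at h2
  have e3 : ((s - a) / (s - r)) • f r + ((a - r) / (s - r)) • f s
      + (((s - b) / (s - r)) • f r + ((b - r) / (s - r)) • f s) = f r + f s := by
    have hb : b = r + s - a := by linarith
    subst hb
    simp only [smul_eq_mul]; field_simp; ring
  linarith

/-- Aggregating the facilities into full ones and one partial one does not increase the cost. -/
theorem exists_full_add_partial (hf : IsCapacityCost f) {u : ℝ} :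
    ∀ {N : ℕ}, 0 < N → ∀ y : Fin N → ℝ, (∀ n, 0 ≤ y n) → (∀ n, y n ≤ u) →
      ∃ (m : ℕ) (r : ℝ), m < N ∧ 0 ≤ r ∧ r ≤ u ∧ u * m + r = ∑ n, y n ∧
        f r + m * f u ≤ ∑ n, f (y n) := by
  intro N hN
  induction N, hN using Nat.le_induction with
  | base =>
    intro y h0 h1
    -- The partial capacity may equal `u`: this is what lets the count stay below `N` even when all
    -- facilities are full.
    exact ⟨0, y 0, by simp, h0 0, h1 0, by simp, by simp⟩
  | succ N hN ih =>
    intro y h0 h1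
    obtain ⟨m, r, hm, hr0, hru, hsum, hcost⟩ :=
      ih (fun n => y n.castSucc) (fun n => h0 _) fun n => h1 _
    have hy0 := h0 (Fin.last N)
    have hyu := h1 (Fin.last N)
    -- If the partial facility and the new one fit together, they merge and one is emptied;
    -- otherwise one is filled and the excess over `u` stays partial.
    rcases le_total (r + y (Fin.last N)) u with h | h
    · refine ⟨m, r + y (Fin.last N), hm.trans N.lt_succ_self, add_nonneg hr0 hy0, h, ?_, ?_⟩
      · rw [Fin.sum_univ_castSucc, ← hsum]; ring
      · have := hf.add_le_add_of_mem_Icc le_rfl hr0 hy0 (zero_add (r + y (Fin.last N)))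
        rw [hf.zero] at this
        rw [Fin.sum_univ_castSucc]
        linarith
    · refine ⟨m + 1, r + y (Fin.last N) - u, by omega, by linarith, by linarith, ?_, ?_⟩
      · rw [Fin.sum_univ_castSucc, ← hsum]; push_cast; ring
      · have := hf.add_le_add_of_mem_Icc (r := r + y (Fin.last N) - u) (s := u) (a := r)
          (b := y (Fin.last N)) (by linarith) (by linarith) (by linarith) (by ring)
        rw [Fin.sum_univ_castSucc]
        push_cast
        linarith

end IsCapacityCost

/-! ### From counts back to individual facilities -/

/-- Capacities of `N` facilities, of which `m` are full and one has capacity `r`. -/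
def spread (u r : ℝ) (m : ℕ) {N : ℕ} (n : Fin N) : ℝ :=
  if (n : ℕ) < m then u else if (n : ℕ) = m then r else 0

theorem sum_map_spread {f : ℝ → ℝ} (hf : f 0 = 0) (u r : ℝ) {m N : ℕ} (hm : m < N) :
    ∑ n : Fin N, f (spread u r m n) = f r + m * f u := by
  unfold spread
  rw [Fin.sum_univ_eq_sum_range
    (fun n => f (if n < m then u else if n = m then r else 0)) N]
  -- The facilities split into `m` full ones, the partial one, and `k` empty ones, which are free
  -- because `f 0 = 0`.
  obtain ⟨k, rfl⟩ := Nat.exists_eq_add_of_lt hm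
  rw [show m + k + 1 = (m + 1) + k by ring, Finset.sum_range_add, Finset.sum_range_succ,
    Finset.sum_congr rfl (g := fun _ => f u)
      (fun x hx => by rw [if_pos (Finset.mem_range.1 hx)]),
    Finset.sum_eq_zero (s := Finset.range k)
      (fun x _ => by rw [if_neg (by omega), if_neg (by omega), hf])]
  simp
  ring

theorem sum_spread (u r : ℝ) {m N : ℕ} (hm : m < N) :
    ∑ n : Fin N, spread u r m n = u * m + r := by
  have := sum_map_spread (f := fun x => x) rfl u r hm
  rw [this]; ring

theorem spread_mem_Icc {u r : ℝ} (hr : 0 ≤ r) (hru : r ≤ u) (m : ℕ) {N : ℕ} (n : Fin N) :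
    spread u r m n ∈ Set.Icc 0 u := by
  unfold spread
  split_ifs <;> constructor <;> linarith


/-! ### Operational decisions as vectors and their linear forms -/

/-- Indices of the operational decisions. -/
inductive OpIdx (I J : Type u) {K : Type u} (Z : Type u) (M : Setting K) : Type u
  | NMNB (t : Fin M.T) (w : M.Node t) (z : Z) (k : K)
  | INVNB (t : Fin M.T) (w : M.Node t) (z : Z) (k : M.Cath)
  | NMCP (t : Fin M.T) (w : M.Node t) (z : Z) (k : M.NonCath)
  | MCCP (t : Fin M.T) (w : M.Node t) (z : Z) (k : M.NonCath)
  | CPINV (t : Fin M.T) (w : M.Node t) (z : Z) (k : M.Cath)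
  | INVMC (t : Fin M.T) (w : M.Node t) (z : Z) (k : M.NonCath)
  | RMINV (t : Fin M.T) (w : M.Node t) (z : Z) (k : K)
  | RMS (t : Fin M.T) (w : M.Node t) (z : Z) (k : K)
  | RBRM (t : Fin M.T) (w : M.Node t) (z : Z) (i : I) (j : J)
  | RB (t : Fin (M.T + 1)) (w : M.NodeAt t) (z : Z) (i : I)
  | INV (t : Fin (M.T + 1)) (w : M.NodeAt t) (z : Z) (k : K)
  | TRRB (t : Fin M.T) (w : M.Node t) (z : Z) (z' : {z' : Z // z' ≠ z}) (i : I)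
  | TRRM (t : Fin M.T) (w : M.Node t) (z : Z) (z' : {z' : Z // z' ≠ z}) (k : K)

/-- Indices of the linear forms in the operational decisions that are bounded by the
constraints. -/
inductive FormIdx (I J : Type u) {K : Type u} (Z : Type u) (M : Setting K) : Type u
  | nbCath (t : Fin M.T) (w : M.Node t) (z : Z) (k : M.Cath)
  | nbNonCath (t : Fin M.T) (w : M.Node t) (z : Z) (k : M.NonCath)
  | cp (t : Fin M.T) (w : M.Node t) (z : Z) (k : M.NonCath)
  | mc (t : Fin M.T) (w : M.Node t) (z : Z) (k : M.NonCath)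
  | recy (t : Fin M.T) (w : M.Node t) (z : Z) (k : K)
  | initRB (w : M.NodeAt 0) (z : Z) (i : I)
  | initINV (w : M.NodeAt 0) (z : Z) (k : K)
  | rb (t : Fin M.T) (w : M.Node t) (z : Z) (i : I)
  | invNonCath (t : Fin M.T) (w : M.Node t) (z : Z) (k : M.NonCath)
  | invCath (t : Fin M.T) (w : M.Node t) (z : Z) (k : M.Cath)
  | RBRM (t : Fin M.T) (w : M.Node t) (z : Z) (i : I) (j : J)
  | CPINV (t : Fin M.T) (w : M.Node t) (z : Z) (k : M.Cath)

/-- The operational decisions given by a vector. -/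
def OpVars.ofVec {I J K Z : Type u} {M : Setting K} (a : OpIdx I J Z M → ℝ) :
    OpVars I J Z M where
  NMNB t w z k := a (.NMNB t w z k)
  INVNB t w z k := a (.INVNB t w z k)
  NMCP t w z k := a (.NMCP t w z k)
  MCCP t w z k := a (.MCCP t w z k)
  CPINV t w z k := a (.CPINV t w z k)
  INVMC t w z k := a (.INVMC t w z k)
  RMINV t w z k := a (.RMINV t w z k)
  RMS t w z k := a (.RMS t w z k)
  RBRM t w z i j := a (.RBRM t w z i j)
  RB t w z i := a (.RB t w z i)
  INV t w z k := a (.INV t w z k)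
  TRRB t w z z' i := a (.TRRB t w z z' i)
  TRRM t w z z' k := a (.TRRM t w z z' k)

/-- The vector of operational decisions. -/
def OpVars.toVec {I J K Z : Type u} {M : Setting K} (x : OpVars I J Z M) :
    OpIdx I J Z M → ℝ
  | .NMNB t w z k => x.NMNB t w z k
  | .INVNB t w z k => x.INVNB t w z k
  | .NMCP t w z k => x.NMCP t w z k
  | .MCCP t w z k => x.MCCP t w z k
  | .CPINV t w z k => x.CPINV t w z k
  | .INVMC t w z k => x.INVMC t w z k
  | .RMINV t w z k => x.RMINV t w z k
  | .RMS t w z k => x.RMS t w z k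
  | .RBRM t w z i j => x.RBRM t w z i j
  | .RB t w z i => x.RB t w z i
  | .INV t w z k => x.INV t w z k
  | .TRRB t w z z' i => x.TRRB t w z z' i
  | .TRRM t w z z' k => x.TRRM t w z z' k

section

variable {I J K Z : Type u} {M : Setting K}

theorem OpVars.ofVec_toVec (x : OpVars I J Z M) : OpVars.ofVec x.toVec = x := rfl

theorem OpVars.nonneg_ofVec_iff {a : OpIdx I J Z M → ℝ} : (OpVars.ofVec a).Nonneg ↔ 0 ≤ a := by
  constructor
  · rintro ⟨h1, h2, h3, h4, h5, h6, h7, h8, h9, h10, h11, h12, h13⟩ i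
    cases i
    exacts [h1 .., h2 .., h3 .., h4 .., h5 .., h6 .., h7 .., h8 .., h9 .., h10 .., h11 ..,
      h12 .., h13 ..]
  · intro h
    constructor <;> intros <;> exact h _

/-- This bound does not involve `y`; it limits both the sales revenue and the linear forms. -/
theorem rbrm_le [Fintype I] {D : Params I J Z M} {x : OpVars I J Z M} {y : CapVars J Z M} (hx : x.Nonneg)
    (h : Capacity D x y) (t : Fin M.T) (w : M.Node t) (z : Z) (i : I) (j : J) :
    x.RBRM t w z i j ≤ M.nREC (M.plan t) * D.uREC :=
  calc x.RBRM t w z i j ≤ ∑ i, x.RBRM t w z i j :=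
        Finset.single_le_sum (f := fun i => x.RBRM t w z i j) (fun i _ => hx.RBRM t w z i j)
          (Finset.mem_univ i)
    _ ≤ ∑ n, y.REC z (M.plan t) j n := h.recCap j t z w
    _ ≤ ∑ _n : Fin (M.nREC (M.plan t)), D.uREC := Finset.sum_le_sum fun n _ => h.recUB j _ z n
    _ = M.nREC (M.plan t) * D.uREC := by simp

theorem cpinv_le [Fintype I] {D : Params I J Z M} {x : OpVars I J Z M} {y : CapVars J Z M}
    (h : Capacity D x y) (t : Fin M.T) (w : M.Node t) (z : Z) (k : M.Cath) :
    x.CPINV t w z k ≤ M.nCP (M.plan t) k * D.uCP :=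
  calc x.CPINV t w z k ≤ ∑ n, y.CP z (M.plan t) k n := h.cpCap k t z w
    _ ≤ ∑ _n : Fin (M.nCP (M.plan t) k), D.uCP := Finset.sum_le_sum fun n _ => h.cpUB k _ z n
    _ = M.nCP (M.plan t) k * D.uCP := by simp

variable [Fintype I] [Fintype J] [Fintype K] [DecidableEq K] [Fintype Z] [DecidableEq Z]

set_option synthInstance.maxSize 100000 in
set_option synthInstance.maxHeartbeats 400000 in
instance : Fintype (OpIdx I J Z M) := Fintype.ofEquiv _ (proxy_equiv% (OpIdx I J Z M))

set_option synthInstance.maxSize 100000 in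
set_option synthInstance.maxHeartbeats 400000 in
instance : Fintype (FormIdx I J Z M) := Fintype.ofEquiv _ (proxy_equiv% (FormIdx I J Z M))

/-- The linear forms in the operational decisions that are bounded by the constraints. -/
def forms (D : Params I J Z M) (x : OpVars I J Z M) : FormIdx I J Z M → ℝ
  | .nbCath t w z k => x.NMNB t w z k + x.INVNB t w z k
  | .nbNonCath t w z k => x.NMNB t w z k
  | .cp t w z k =>
    ∑ k' : M.Cath, D.ΔCP k' k * x.CPINV t w z k' - (x.NMCP t w z k + x.MCCP t w z k)
  | .mc t w z k => ∑ k' : M.NonCath, D.ΔMC k' k * x.MCCP t w z k' - x.INVMC t w z k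
  | .recy t w z k =>
    x.RMINV t w z k + x.RMS t w z k - ∑ i, ∑ j, D.ΔREC k i j * x.RBRM t w z i j
  | .initRB w z i => x.RB 0 w z i
  | .initINV w z k => x.INV 0 w z k
  | .rb t w z i => x.RB t.succ w z i - (x.RB t.castSucc (M.prev t w) z i + x.netRB t w z i
      - ∑ j, x.RBRM t w z i j)
  | .invNonCath t w z k => x.INV t.succ w z k - (x.INV t.castSucc (M.prev t w) z k
      + x.netRM t w z k + x.RMINV t w z k - x.INVMC t w z k)
  | .invCath t w z k => x.INV t.succ w z k - (x.INV t.castSucc (M.prev t w) z k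
      + x.netRM t w z k + x.RMINV t w z k + x.CPINV t w z k - x.INVNB t w z k)
  | .RBRM t w z i j => x.RBRM t w z i j
  | .CPINV t w z k => x.CPINV t w z k

/-- The values of the forms prescribed by the production and inventory constraints, with given
values for the recycling and cathode production quantities. -/
def prescribed (D : Params I J Z M) (r : ∀ t : Fin M.T, M.Node t → Z → I → J → ℝ)
    (c : ∀ t : Fin M.T, M.Node t → Z → M.Cath → ℝ) : FormIdx I J Z M → ℝ
  | .nbCath t w z k => ∑ i, D.ΔNB i k * D.d t w z i
  | .nbNonCath t w z k => ∑ i, D.ΔNB i k * D.d t w z i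
  | .rb t w z i => D.s t w z i
  | .RBRM t w z i j => r t w z i j
  | .CPINV t w z k => c t w z k
  | _ => 0

/-- The right-hand side depends on `x` only through two families that are themselves forms, at which
the equation is a tautology. Listing them as forms lets the fibre of `forms` also determine the
capacity constraints. -/
theorem production_inventory_iff (D : Params I J Z M) (x : OpVars I J Z M) :
    Production D x ∧ Inventory D x ↔ forms D x = prescribed D x.RBRM x.CPINV := by
  constructor
  · rintro ⟨hP, hI⟩
    ext i
    cases i with
    | nbCath t w z k => exact (hP.nbCath t w z k).symm
    | nbNonCath t w z k => exact (hP.nbNonCath t w z k).symm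
    | cp t w z k => exact sub_eq_zero.2 (hP.cp t w z k)
    | mc t w z k => exact sub_eq_zero.2 (hP.mc t w z k)
    | recy t w z k => exact sub_eq_zero.2 (hP.recy t w z k)
    | initRB w z i => exact hI.initRB w z i
    | initINV w z k => exact hI.initINV w z k
    | rb t w z i =>
      simp only [forms, prescribed]
      linarith [hI.rb t w z i]
    | invNonCath t w z k => exact sub_eq_zero.2 (hI.invNonCath t w z k)
    | invCath t w z k => exact sub_eq_zero.2 (hI.invCath t w z k)
    | RBRM t w z i j => rfl
    | CPINV t w z k => rfl
  · intro h
    have h' := congrFun h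
    refine
      ⟨{ nbCath := fun t w z k => (h' (.nbCath t w z k)).symm
         nbNonCath := fun t w z k => (h' (.nbNonCath t w z k)).symm
         cp := fun t w z k => sub_eq_zero.1 (h' (.cp t w z k))
         mc := fun t w z k => sub_eq_zero.1 (h' (.mc t w z k))
         recy := fun t w z k => sub_eq_zero.1 (h' (.recy t w z k)) },
       { initRB := fun w z i => h' (.initRB w z i)
         initINV := fun w z k => h' (.initINV w z k)
         rb := fun t w z i => ?_
         invNonCath := fun t w z k => sub_eq_zero.1 (h' (.invNonCath t w z k))
         invCath := fun t w z k => sub_eq_zero.1 (h' (.invCath t w z k)) }⟩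
    have := h' (.rb t w z i)
    simp only [forms, prescribed] at this
    linarith

/-- `forms` as a linear map. -/
def formsMap (D : Params I J Z M) : (OpIdx I J Z M → ℝ) →ₗ[ℝ] (FormIdx I J Z M → ℝ) where
  toFun a := forms D (OpVars.ofVec a)
  map_add' a b := by
    ext i
    cases i <;> simp only [forms, OpVars.ofVec, OpVars.netRB, OpVars.netRM, mul_add,
      Finset.sum_add_distrib, Finset.sum_sub_distrib, Pi.add_apply] <;> ring
  map_smul' c a := by
    ext i
    cases i <;> simp only [forms, OpVars.ofVec, OpVars.netRB, OpVars.netRM, mul_add, mul_sub,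
      Finset.mul_sum, Finset.sum_sub_distrib, mul_left_comm c, Pi.smul_apply, smul_eq_mul,
      RingHom.id_apply]

/-- The expected operational cost as a linear map. -/
noncomputable def operationalCost (D : Params I J Z M) : (OpIdx I J Z M → ℝ) →ₗ[ℝ] ℝ where
  toFun a := totalCost D 0 (OpVars.ofVec a)
  map_add' a b := by
    have h : ∀ t w, costOP D (.ofVec (a + b)) t w
        = costOP D (.ofVec a) t w + costOP D (.ofVec b) t w := by
      intro t w
      simp only [costOP, OpVars.ofVec, Pi.add_apply, mul_add, mul_sub, Finset.sum_add_distrib,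
        Finset.sum_sub_distrib]
      ring
    simp only [totalCost, h, mul_add, Finset.sum_add_distrib, Pi.zero_apply, zero_add]
  map_smul' c a := by
    have h : ∀ t w, costOP D (.ofVec (c • a)) t w = c * costOP D (.ofVec a) t w := by
      intro t w
      simp only [costOP, OpVars.ofVec, Pi.smul_apply, smul_eq_mul, mul_add, mul_sub,
        Finset.mul_sum, mul_left_comm c]
    simp only [totalCost, h, Pi.zero_apply, zero_add, Finset.mul_sum, smul_eq_mul,
      RingHom.id_apply, mul_left_comm c]

/-! ### Cost bounds and a feasible point -/

theorem totalCost_eq (D : Params I J Z M) (f : Fin M.T → ℝ) (x : OpVars I J Z M) :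
    totalCost D f x = totalCost D 0 x + ∑ t : Fin M.T, (1 - D.γ) ^ (t : ℕ) * f t := by
  simp only [totalCost, mul_add, Finset.sum_add_distrib, Pi.zero_apply, zero_add]
  ring

theorem totalCost_mono {D : Params I J Z M} (hD : D.Standing) {f g : Fin M.T → ℝ}
    (h : ∀ t, f t ≤ g t) (x : OpVars I J Z M) : totalCost D f x ≤ totalCost D g x := by
  rw [totalCost_eq, totalCost_eq D g]
  have := hD.γ_lt_one
  have hγ : 0 ≤ 1 - D.γ := by linarith
  gcongr with t
  exact h t

/-- The cost of operation is at least minus the largest possible sales revenue. -/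
theorem le_totalCost {D : Params I J Z M} (hD : D.Standing) {x : OpVars I J Z M}
    {y : CapVars J Z M} (hx : x.Nonneg) (hP : Production D x) (h : Capacity D x y) :
    ∑ t : Fin M.T, (1 - D.γ) ^ (t : ℕ) * ∑ w : M.Node t, D.p (M.stage t.succ) w *
      ∑ _z : Z, ∑ k : K, D.v t w k * (- (D.η * ∑ i, ∑ j, D.ΔREC k i j *
        (M.nREC (M.plan t) * D.uREC))) ≤ totalCost D 0 x := by
  have hγ := hD.γ_lt_one
  simp only [totalCost, Pi.zero_apply, zero_add]
  refine Finset.sum_le_sum fun t _ => mul_le_mul_of_nonneg_left ?_ (pow_nonneg (by linarith) _)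
  refine Finset.sum_le_sum fun w _ => mul_le_mul_of_nonneg_left ?_ (hD.p_nonneg _ _)
  refine Finset.sum_le_sum fun z _ => ?_
  have h1 : 0 ≤ ∑ k, D.cNBNM t w k * x.NMNB t w z k :=
    Finset.sum_nonneg fun k _ => mul_nonneg (hD.cNBNM_nonneg ..) (hx.NMNB ..)
  have h2 : 0 ≤ ∑ k : M.NonCath, (D.cCPNM t w k * x.NMCP t w z k + D.cMC t w z k * x.MCCP t w z k) :=
    Finset.sum_nonneg fun k _ => add_nonneg (mul_nonneg (hD.cCPNM_nonneg ..) (hx.NMCP ..))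
      (mul_nonneg (hD.cMC_nonneg ..) (hx.MCCP ..))
  have h3 : 0 ≤ ∑ k : M.Cath, D.cCP t w z k * x.CPINV t w z k :=
    Finset.sum_nonneg fun k _ => mul_nonneg (hD.cCP_nonneg ..) (hx.CPINV ..)
  have h4 : 0 ≤ ∑ i, ∑ j, D.cREC t w z i j * x.RBRM t w z i j :=
    Finset.sum_nonneg fun i _ => Finset.sum_nonneg fun j _ =>
      mul_nonneg (hD.cREC_nonneg ..) (hx.RBRM ..)
  have h5 : 0 ≤ ∑ z' : {z' : Z // z' ≠ z}, ((∑ k, D.cTRRM z z' * x.TRRM t w z z' k)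
        + ∑ i, D.cTRRB z z' * x.TRRB t w z z' i) :=
    Finset.sum_nonneg fun z' _ => add_nonneg
      (Finset.sum_nonneg fun k _ => mul_nonneg (hD.cTRRM_nonneg ..) (hx.TRRM ..))
      (Finset.sum_nonneg fun k _ => mul_nonneg (hD.cTRRB_nonneg ..) (hx.TRRB ..))
  have h6 : ∑ k : K, D.v t w k * (- (D.η * ∑ i, ∑ j, D.ΔREC k i j *
        (M.nREC (M.plan t) * D.uREC)))
      ≤ ∑ k, D.v t w k * (D.ρ * x.INV t.succ w z k - D.η * x.RMS t w z k) := by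
    refine Finset.sum_le_sum fun k _ => mul_le_mul_of_nonneg_left ?_ (hD.v_nonneg ..)
    -- Sales are the only source of negative cost, and they cannot exceed what recycling at full
    -- capacity recovers.
    have h7 : x.RMS t w z k ≤ ∑ i, ∑ j, D.ΔREC k i j * (M.nREC (M.plan t) * D.uREC) :=
      calc x.RMS t w z k ≤ x.RMINV t w z k + x.RMS t w z k :=
            le_add_of_nonneg_left (hx.RMINV ..)
        _ = ∑ i, ∑ j, D.ΔREC k i j * x.RBRM t w z i j := hP.recy ..
        _ ≤ _ := Finset.sum_le_sum fun i _ => Finset.sum_le_sum fun j _ =>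
            mul_le_mul_of_nonneg_left (rbrm_le hx h ..) (hD.ΔREC_nonneg ..)
    have h8 := mul_le_mul_of_nonneg_left h7 hD.η_nonneg
    have h9 := mul_nonneg hD.ρ_nonneg (hx.INV t.succ w z k)
    linarith
  linarith

/-- With zero capacity, all demand is met by new material and retired batteries pile up in their
zone, the stock being computed recursively along ancestors. -/
theorem feasibleP_nonempty {D : Params I J Z M} (hD : D.Standing) : (feasibleP D).Nonempty := by
  let RB : ∀ t : Fin (M.T + 1), M.NodeAt t → Z → I → ℝ :=
    Fin.induction (fun _ _ _ => 0) fun t f w z i => f (M.prev t w) z i + D.s t w z i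
  have hRB : ∀ t w z i, 0 ≤ RB t w z i := by
    intro t
    induction t using Fin.induction with
    | zero => exact fun w z i => le_rfl
    | succ t ih => exact fun w z i => add_nonneg (ih ..) (hD.s_nonneg ..)
  have hd : ∀ t w z k, 0 ≤ ∑ i, D.ΔNB i k * D.d t w z i := fun t w z k =>
    Finset.sum_nonneg fun i _ => mul_nonneg (hD.ΔNB_nonneg ..) (hD.d_nonneg ..)
  refine ⟨(⟨fun t w z k => ∑ i, D.ΔNB i k * D.d t w z i, 0, 0, 0, 0, 0, 0, 0, 0, RB, 0, 0, 0⟩,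
    ⟨0, 0⟩), ?_, ?_, ?_, ?_⟩
  · constructor <;> intros <;> first | exact le_rfl | exact hd .. | exact hRB ..
  · constructor <;> intros <;> simp
  · constructor
    · exact fun w z i => rfl
    · exact fun w z k => rfl
    · intro t w z i
      simp [OpVars.netRB, RB]
    all_goals
      intros
      simp [OpVars.netRM]
  · have hu := hD.uREC_pos.le
    have hu' := hD.uCP_pos.le
    constructor <;> intros <;> simp [hu, hu']

/-! ### Passing between the two models -/

/-- A solution of the reformulated model with the same operational decisions and the same total
capacities, at no greater cost. -/
theorem exists_feasiblePMI_le {D : Params I J Z M} (hD : D.Standing)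
    {q : OpVars I J Z M × CapVars J Z M} (hq : q ∈ feasibleP D) :
    ∃ q' ∈ feasiblePMI D, objectivePMI D q' ≤ objectiveP D q := by
  obtain ⟨hx, hP, hI, hC⟩ := hq
  have hR : ∀ z l j, _ := fun z l j => (hD.fREC_cost z j).exists_full_add_partial (u := D.uREC)
    (hD.nREC_pos l) (q.2.REC z l j) (fun n => hC.recNonneg j l z n) (fun n => hC.recUB j l z n)
  have hCP : ∀ z l k, _ := fun z l k => (hD.fCP_cost z k).exists_full_add_partial (u := D.uCP)
    (hD.nCP_pos l k) (q.2.CP z l k) (fun n => hC.cpNonneg k l z n) (fun n => hC.cpUB k l z n)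
  choose m r hm hr0 hru hsum hcost using hR
  choose m' r' hm' hr0' hru' hsum' hcost' using hCP
  refine ⟨(q.1, ⟨m, r, m', r'⟩), ⟨hx, hP, hI, ?_⟩, ?_⟩
  · exact
      { recCap := fun j t z w => (hC.recCap j t z w).trans_eq (hsum ..).symm
        cpCap := fun k t z w => (hC.cpCap k t z w).trans_eq (hsum' ..).symm
        recMono := fun j l' l z h => by
          simpa only [hsum] using hC.recMono j l' l z h
        cpMono := fun k l' l z h => by
          simpa only [hsum'] using hC.cpMono k l' l z h
        recInt := fun j l z => hm z l j
        cpInt := fun k l z => hm' z l k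
        recUB := fun j l z => hru z l j
        cpUB := fun k l z => hru' z l k
        recNonneg := fun j l z => hr0 z l j
        cpNonneg := fun k l z => hr0' z l k }
  · refine totalCost_mono hD (fun t => ?_) _
    exact Finset.sum_le_sum fun z _ => add_le_add (Finset.sum_le_sum fun j _ => hcost ..)
      (Finset.sum_le_sum fun k _ => hcost' ..)

/-- A solution of the original model with the same operational decisions and the same total
capacities, at the same cost. -/
theorem exists_feasibleP_eq {D : Params I J Z M} (hD : D.Standing)
    {q : OpVars I J Z M × CapVarsMI J Z M} (hq : q ∈ feasiblePMI D) :
    ∃ q' ∈ feasibleP D, objectiveP D q' = objectivePMI D q := by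
  obtain ⟨hx, hP, hI, hC⟩ := hq
  have hR := fun z l j => sum_spread D.uREC (q.2.RECplus z l j) (hC.recInt j l z)
  have hCP := fun z l k => sum_spread D.uCP (q.2.CPplus z l k) (hC.cpInt k l z)
  refine ⟨(q.1, ⟨fun z l j => spread D.uREC (q.2.RECplus z l j) (q.2.REC z l j),
    fun z l k => spread D.uCP (q.2.CPplus z l k) (q.2.CP z l k)⟩), ⟨hx, hP, hI, ?_⟩, ?_⟩
  · exact
      { recCap := fun j t z w => (hC.recCap j t z w).trans_eq (hR ..).symm
        cpCap := fun k t z w => (hC.cpCap k t z w).trans_eq (hCP ..).symm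
        recMono := fun j l' l z h => by
          simpa only [hR] using hC.recMono j l' l z h
        cpMono := fun k l' l z h => by
          simpa only [hCP] using hC.cpMono k l' l z h
        recUB := fun j l z n => (spread_mem_Icc (hC.recNonneg j l z) (hC.recUB j l z) _ n).2
        cpUB := fun k l z n => (spread_mem_Icc (hC.cpNonneg k l z) (hC.cpUB k l z) _ n).2
        recNonneg := fun j l z n => (spread_mem_Icc (hC.recNonneg j l z) (hC.recUB j l z) _ n).1
        cpNonneg := fun k l z n => (spread_mem_Icc (hC.cpNonneg k l z) (hC.cpUB k l z) _ n).1 }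
  · have h : costPL D ⟨fun z l j => spread D.uREC (q.2.RECplus z l j) (q.2.REC z l j),
        fun z l k => spread D.uCP (q.2.CPplus z l k) (q.2.CP z l k)⟩ = costPLMI D q.2 := by
      funext t
      exact Finset.sum_congr rfl fun z _ => congrArg₂ _
        (Finset.sum_congr rfl fun j _ =>
          sum_map_spread (hD.fREC_cost z j).zero _ _ (hC.recInt ..))
        (Finset.sum_congr rfl fun k _ => sum_map_spread (hD.fCP_cost z k).zero _ _ (hC.cpInt ..))
    simp only [objectiveP, objectivePMI, h]

/-! ### Attainment in the original model -/

/-- The capacity decisions of the original model as a pair of families of numbers. -/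
abbrev CapVec (J : Type u) {K : Type u} (Z : Type u) (M : Setting K) : Type u :=
  (Z → ∀ l : Fin M.L, J → Fin (M.nREC l) → ℝ) ×
    (Z → ∀ (l : Fin M.L) (k : M.Cath), Fin (M.nCP l k) → ℝ)

/-- The solutions of the original model, as vectors. -/
def feasibleVec (D : Params I J Z M) : Set ((OpIdx I J Z M → ℝ) × CapVec J Z M) :=
  {q | (OpVars.ofVec q.1, (⟨q.2.1, q.2.2⟩ : CapVars J Z M)) ∈ feasibleP D}

theorem isClosed_feasibleVec (D : Params I J Z M) : IsClosed (feasibleVec D) := by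
  have h : feasibleVec D = {q | 0 ≤ q.1} ∩
      {q | formsMap D q.1 = prescribed D (OpVars.ofVec q.1).RBRM
        (OpVars.ofVec q.1).CPINV} ∩
      {q | Capacity D (OpVars.ofVec q.1) ⟨q.2.1, q.2.2⟩} := by
    ext q
    change _ ∧ _ ∧ _ ∧ _ ↔ (_ ∧ _) ∧ _
    rw [← and_assoc (b := Inventory D _), production_inventory_iff, OpVars.nonneg_ofVec_iff,
      and_assoc]
    rfl
  rw [h]
  refine ((isClosed_le continuous_const continuous_fst).inter (isClosed_eq ?_ ?_)).inter ?_
  · exact (LinearMap.continuous_of_finiteDimensional (formsMap D)).comp continuous_fst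
  · refine continuous_pi fun i => ?_
    cases i <;> simp only [prescribed, OpVars.ofVec] <;> fun_prop
  · have h' : {q : (OpIdx I J Z M → ℝ) × CapVec J Z M |
        Capacity D (OpVars.ofVec q.1) ⟨q.2.1, q.2.2⟩} =
        {q | ∀ j t z w, ∑ i, q.1 (.RBRM t w z i j) ≤ ∑ n, q.2.1 z (M.plan t) j n} ∩
        {q | ∀ (k : M.Cath) t z w, q.1 (.CPINV t w z k) ≤ ∑ n, q.2.2 z (M.plan t) k n} ∩
        {q | ∀ j (l' l : Fin M.L) z, (l' : ℕ) + 1 = l →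
          ∑ n, q.2.1 z l' j n ≤ ∑ n, q.2.1 z l j n} ∩
        {q | ∀ (k : M.Cath) (l' l : Fin M.L) z, (l' : ℕ) + 1 = l →
          ∑ n, q.2.2 z l' k n ≤ ∑ n, q.2.2 z l k n} ∩
        {q | ∀ j l z n, q.2.1 z l j n ≤ D.uREC} ∩ {q | ∀ k l z n, q.2.2 z l k n ≤ D.uCP} ∩
        {q | ∀ j l z n, 0 ≤ q.2.1 z l j n} ∩ {q | ∀ k l z n, 0 ≤ q.2.2 z l k n} := by
      ext q
      constructor
      · rintro ⟨h1, h2, h3, h4, h5, h6, h7, h8⟩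
        exact ⟨⟨⟨⟨⟨⟨⟨h1, h2⟩, h3⟩, h4⟩, h5⟩, h6⟩, h7⟩, h8⟩
      · rintro ⟨⟨⟨⟨⟨⟨⟨h1, h2⟩, h3⟩, h4⟩, h5⟩, h6⟩, h7⟩, h8⟩
        exact ⟨h1, h2, h3, h4, h5, h6, h7, h8⟩
    rw [h']
    simp only [Set.ofPred_forall]
    refine .inter (.inter (.inter (.inter (.inter (.inter (.inter ?_ ?_) ?_) ?_) ?_) ?_) ?_) ?_ <;>
    · repeat' refine isClosed_iInter fun _ => ?_
      exact isClosed_le (by fun_prop) (by fun_prop)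

/-- The capacity constraints involve `x` only through `RBRM` and `CPINV`, which are coordinates of
`formsMap`; production and inventory are equations between forms. -/
theorem feasibleVec_congr {D : Params I J Z M} {q : (OpIdx I J Z M → ℝ) × CapVec J Z M}
    (hq : q ∈ feasibleVec D) {a : OpIdx I J Z M → ℝ} (ha : 0 ≤ a)
    (h : formsMap D a = formsMap D q.1) : (a, q.2) ∈ feasibleVec D := by
  obtain ⟨hx, hP, hI, hC⟩ := hq
  have hRB : (OpVars.ofVec a).RBRM = (OpVars.ofVec q.1).RBRM := by
    funext t w z i j
    exact congrFun h (.RBRM t w z i j)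
  have hCP : (OpVars.ofVec a).CPINV = (OpVars.ofVec q.1).CPINV := by
    funext t w z k
    exact congrFun h (.CPINV t w z k)
  have h1 := (production_inventory_iff D (OpVars.ofVec a)).2 (by
    rw [hRB, hCP]
    exact Eq.trans h ((production_inventory_iff D _).1 ⟨hP, hI⟩))
  refine ⟨OpVars.nonneg_ofVec_iff.2 ha, h1.1, h1.2, { hC with recCap := ?_, cpCap := ?_ }⟩
  · simp only [hRB]
    exact hC.recCap
  · simp only [hCP]
    exact hC.cpCap

theorem formsMap_mem_Icc {D : Params I J Z M} {q : (OpIdx I J Z M → ℝ) × CapVec J Z M}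
    (hq : q ∈ feasibleVec D) :
    formsMap D q.1 ∈ Set.Icc (prescribed D 0 0)
      (prescribed D (fun t _ _ _ _ => M.nREC (M.plan t) * D.uREC)
        fun t _ _ k => M.nCP (M.plan t) k * D.uCP) := by
  obtain ⟨hx, hP, hI, hC⟩ := hq
  have h : formsMap D q.1 = _ := (production_inventory_iff D _).1 ⟨hP, hI⟩
  rw [h]
  -- Only the recycling and cathode production coordinates vary; all others are prescribed by the
  -- data.
  constructor <;> intro i <;> cases i <;> simp only [prescribed, le_refl]
  · exact hx.RBRM ..
  · exact hx.CPINV ..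
  · exact rbrm_le hx hC ..
  · exact cpinv_le hC ..

/-- Total discounted planning cost, with the cost functions extended by `0` to negative
capacities. -/
noncomputable def planningCost (D : Params I J Z M) (y : CapVec J Z M) : ℝ :=
  ∑ t : Fin M.T, (1 - D.γ) ^ (t : ℕ) *
    ∑ z, ((∑ j, ∑ n, D.fREC z j (max (y.1 z (M.plan t) j n) 0))
      + ∑ k : M.Cath, ∑ n, D.fCP z k (max (y.2 z (M.plan t) k n) 0))

omit [Fintype I] [Fintype K] [DecidableEq K] [DecidableEq Z] in
theorem lowerSemicontinuous_planningCost {D : Params I J Z M} (hD : D.Standing) :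
    LowerSemicontinuous (planningCost D) := by
  have hγ : 0 ≤ 1 - D.γ := sub_nonneg.2 hD.γ_lt_one.le
  refine lowerSemicontinuous_sum fun t _ => ?_
  refine Continuous.comp_lowerSemicontinuous (g := fun a : ℝ => (1 - D.γ) ^ (t : ℕ) * a)
    (by fun_prop) ?_ fun a b h => mul_le_mul_of_nonneg_left h (pow_nonneg hγ _)
  refine lowerSemicontinuous_sum fun z _ => LowerSemicontinuous.add
    (lowerSemicontinuous_sum fun j _ => lowerSemicontinuous_sum fun n _ => ?_)
    (lowerSemicontinuous_sum fun k _ => lowerSemicontinuous_sum fun n _ => ?_)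
  · exact (hD.fREC_cost z j).lowerSemicontinuous.comp
      (g := fun y : CapVec J Z M => y.1 z (M.plan t) j n) (by fun_prop)
  · exact (hD.fCP_cost z k).lowerSemicontinuous.comp
      (g := fun y : CapVec J Z M => y.2 z (M.plan t) k n) (by fun_prop)

/-- The truncation in `planningCost`, needed for lower semicontinuity on the whole space, is
inactive at feasible points because capacities are nonnegative there. -/
theorem operationalCost_add_planningCost {D : Params I J Z M}
    {q : (OpIdx I J Z M → ℝ) × CapVec J Z M} (hq : q ∈ feasibleVec D) :
    operationalCost D q.1 + planningCost D q.2
      = objectiveP D (OpVars.ofVec q.1, ⟨q.2.1, q.2.2⟩) := by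
  obtain ⟨-, -, -, hC⟩ := hq
  have h1 : ∀ z l j n, max (q.2.1 z l j n) 0 = q.2.1 z l j n :=
    fun z l j n => max_eq_left (hC.recNonneg j l z n)
  have h2 : ∀ z l k n, max (q.2.2 z l k n) 0 = q.2.2 z l k n :=
    fun z l k n => max_eq_left (hC.cpNonneg k l z n)
  simp only [planningCost, h1, h2]
  exact (totalCost_eq ..).symm

theorem snd_mem_Icc_of_mem_feasibleVec {D : Params I J Z M}
    {q : (OpIdx I J Z M → ℝ) × CapVec J Z M} (hq : q ∈ feasibleVec D) :
    q.2 ∈ Set.Icc (0 : CapVec J Z M) (fun _ _ _ _ => D.uREC, fun _ _ _ _ => D.uCP) :=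
  ⟨⟨fun z l j n => hq.2.2.2.recNonneg j l z n, fun z l k n => hq.2.2.2.cpNonneg k l z n⟩,
    ⟨fun z l j n => hq.2.2.2.recUB j l z n, fun z l k n => hq.2.2.2.cpUB k l z n⟩⟩

theorem exists_isMinOn_feasibleVec {D : Params I J Z M} (hD : D.Standing) :
    ∃ q ∈ feasibleVec D,
      IsMinOn (fun q => operationalCost D q.1 + planningCost D q.2) (feasibleVec D) q := by
  obtain ⟨q₀, hq₀⟩ := feasibleP_nonempty hD
  have hne : (feasibleVec D).Nonempty := ⟨(q₀.1.toVec, (q₀.2.REC, q₀.2.CP)), hq₀⟩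
  exact exists_isMinOn_linear_add (formsMap D) (operationalCost D)
    (lowerSemicontinuous_planningCost hD) (isClosed_feasibleVec D) hne isCompact_Icc
    (fun q hq => snd_mem_Icc_of_mem_feasibleVec hq)
    (fun q hq => OpVars.nonneg_ofVec_iff.1 hq.1)
    (fun q hq a ha h => feasibleVec_congr hq ha h) isCompact_Icc.isBounded
    (fun q hq => formsMap_mem_Icc hq)
    (fun q hq => le_totalCost hD hq.1 hq.2.1 hq.2.2.2)

theorem exists_isMinOn_objectiveP {D : Params I J Z M} (hD : D.Standing) :
    ∃ q ∈ feasibleP D, IsMinOn (objectiveP D) (feasibleP D) q := by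
  obtain ⟨q, hq, hmin⟩ := exists_isMinOn_feasibleVec hD
  refine ⟨(OpVars.ofVec q.1, ⟨q.2.1, q.2.2⟩), hq, fun r hr => ?_⟩
  have hr' : (r.1.toVec, (r.2.REC, r.2.CP)) ∈ feasibleVec D := hr
  have h := hmin hr'
  simp only [Set.mem_ofPred_eq] at h
  rw [operationalCost_add_planningCost hq, operationalCost_add_planningCost hr',
    OpVars.ofVec_toVec] at h
  exact h

end
end BatteryModel

/-! ### Equality of the optimal values -/

theorem theorem2 {I J K Z : Type u} [Fintype I] [Fintype J] [Fintype K] [DecidableEq K]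
    [Fintype Z] [DecidableEq Z] (M : BatteryModel.Setting K)
    (D : BatteryModel.Params I J Z M) (hD : D.Standing) :
    ∃ v : ℝ,
      BatteryModel.IsOptimalValue (BatteryModel.feasibleP D) (BatteryModel.objectiveP D) v ∧
      BatteryModel.IsOptimalValue (BatteryModel.feasiblePMI D)
        (BatteryModel.objectivePMI D) v := by
  obtain ⟨q, hq, hmin⟩ := BatteryModel.exists_isMinOn_objectiveP hD
  -- The optimum of (P) bounds (PMI) from below by disaggregation; aggregating a minimizer of (P)
  -- then reaches this bound, so (PMI) needs no compactness argument of its own.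
  have hlow : ∀ r ∈ BatteryModel.feasiblePMI D,
      BatteryModel.objectiveP D q ≤ BatteryModel.objectivePMI D r := by
    intro r hr
    obtain ⟨r', hr', h⟩ := BatteryModel.exists_feasibleP_eq hD hr
    exact (hmin hr').trans_eq h
  obtain ⟨q', hq', hle⟩ := BatteryModel.exists_feasiblePMI_le hD hq
  refine ⟨BatteryModel.objectiveP D q, ⟨⟨q, hq, rfl⟩, ?_⟩,
    ⟨⟨q', hq', hle.antisymm (hlow q' hq')⟩, ?_⟩⟩
  · rintro _ ⟨r, hr, rfl⟩
    exact hmin hr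
  · rintro _ ⟨r, hr, rfl⟩
    exact hlow r hr
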